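/- Let $M$ be a smooth $2n$-dimensional manifold and let $\omega$ be a symplectic form on $M$, i.e. a smooth non-degenerate $2$-form with $\mathrm{d}\omega=0$. Let $\nabla$ be any almost symplectic connection on $(M,\omega)$, i.e. a smooth linear connection on $TM$ with $\nabla\omega=0$, possibly with non-zero torsion $T^\nabla(X,Y)=\nabla_XY-\nabla_YX-[X,Y]$. For a frame $e_1,\ldots,e_{2n}$ of a tangent space of $M$ put $\omega_{ij}=\omega(e_i,e_j)$, let $(\omega^{ij})$ be the inverse matrix, $\sum_j\omega_{ij}\omega^{jq}=\delta_i^q$, and let $T_{ijk}=\omega(T^\nabla(e_i,e_j),e_k)$. Then the quadratic torsion invariant $$t^\nabla=\sum_{i,j,k,p,q,l=1}^{2n}T_{ijk}\,T_{pql}\,\omega^{ij}\omega^{kp}\omega^{ql}$$ vanishes at every point of $M$ and in every frame. -/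

import Mathlib

open scoped Manifold ContDiff

namespace AlmostSymplectic

section

variable {n : ℕ} {M : Type*} [TopologicalSpace M]
  [ChartedSpace (EuclideanSpace ℝ (Fin (2 * n))) M] [IsManifold (𝓡 (2 * n)) ∞ M]

variable (n M) in
/-- An almost symplectic structure on a smooth `2n`-manifold `M`: a smooth non-degenerate
`2`-form `Ω`, that is, a smooth section of `Hom(TM, Hom(TM, ℝ))` which is alternating and
non-degenerate on every tangent space. -/
structure AlmostSymplecticForm where
  /-- The bilinear form `Ω_x` on `T_x M`. -/
  toFun : ∀ x : M, TangentSpace (𝓡 (2 * n)) x →L[ℝ] TangentSpace (𝓡 (2 * n)) x →L[ℝ] ℝ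
  contMDiff_toFun :
    ContMDiff (𝓡 (2 * n))
      ((𝓡 (2 * n)).prod 𝓘(ℝ, EuclideanSpace ℝ (Fin (2 * n)) →L[ℝ]
        EuclideanSpace ℝ (Fin (2 * n)) →L[ℝ] ℝ)) ∞
      (fun x ↦ Bundle.TotalSpace.mk' (EuclideanSpace ℝ (Fin (2 * n)) →L[ℝ]
        EuclideanSpace ℝ (Fin (2 * n)) →L[ℝ] ℝ) x (toFun x))
  alternating : ∀ (x : M) (v : TangentSpace (𝓡 (2 * n)) x), toFun x v v = 0
  nondegenerate : ∀ (x : M) (v : TangentSpace (𝓡 (2 * n)) x),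
    (∀ w : TangentSpace (𝓡 (2 * n)) x, toFun x v w = 0) → v = 0

/-- The vector field `X` on `M` is smooth at the point `x`. -/
def SmoothAt (X : ∀ x : M, TangentSpace (𝓡 (2 * n)) x) (x : M) : Prop :=
  ContMDiffAt (𝓡 (2 * n)) (𝓡 (2 * n)).tangent ∞
    (fun y ↦ (⟨y, X y⟩ : TangentBundle (𝓡 (2 * n)) M)) x

namespace AlmostSymplecticForm

/-- The derivative `X (Ω (Y, Z))` of the function `Ω (Y, Z)` along the vector field `X`,
at the point `x`. -/
noncomputable def lieDeriv (Ω : AlmostSymplecticForm n M)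
    (X Y Z : ∀ x : M, TangentSpace (𝓡 (2 * n)) x) (x : M) : ℝ :=
  mvfderiv (𝓡 (2 * n)) (fun y ↦ Ω.toFun y (Y y) (Z y)) x (X x)

open VectorField in
/-- The exterior derivative of `Ω`, evaluated on three vector fields:
`dΩ(X,Y,Z) = X(Ω(Y,Z)) + Y(Ω(Z,X)) + Z(Ω(X,Y)) - Ω([X,Y],Z) - Ω([Y,Z],X) - Ω([Z,X],Y)`. -/
noncomputable def extDeriv (Ω : AlmostSymplecticForm n M)
    (X Y Z : ∀ x : M, TangentSpace (𝓡 (2 * n)) x) (x : M) : ℝ :=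
  Ω.lieDeriv X Y Z x + Ω.lieDeriv Y Z X x + Ω.lieDeriv Z X Y x
    - Ω.toFun x (mlieBracket (𝓡 (2 * n)) X Y x) (Z x)
    - Ω.toFun x (mlieBracket (𝓡 (2 * n)) Y Z x) (X x)
    - Ω.toFun x (mlieBracket (𝓡 (2 * n)) Z X x) (Y x)

/-- `Ω` is symplectic: `dΩ = 0`. The condition is tested on vector fields which are smooth near the
point in question; they realise all triples of tangent vectors, and `dΩ` is a tensor. -/
def IsSymplectic (Ω : AlmostSymplecticForm n M) : Prop :=
  ∀ (x : M) (X Y Z : ∀ x : M, TangentSpace (𝓡 (2 * n)) x),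
    SmoothAt X x → SmoothAt Y x → SmoothAt Z x → Ω.extDeriv X Y Z x = 0

end AlmostSymplecticForm

variable (n M) in
/-- Linear connections on `M`, i.e. covariant derivatives on the tangent bundle.
In Mathlib's argument order, `D Y x (X x)` is `(∇_X Y)(x)`. -/
abbrev LinearConnection :=
  CovariantDerivative (𝓡 (2 * n)) (EuclideanSpace ℝ (Fin (2 * n)))
    (TangentSpace (𝓡 (2 * n)) : M → Type _)

/-- The covariant derivative of `Ω`:
`(∇_X Ω)(Y,Z) = X(Ω(Y,Z)) - Ω(∇_X Y, Z) - Ω(Y, ∇_X Z)`. -/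
noncomputable def covDeriv (D : LinearConnection n M) (Ω : AlmostSymplecticForm n M)
    (X Y Z : ∀ x : M, TangentSpace (𝓡 (2 * n)) x) (x : M) : ℝ :=
  Ω.lieDeriv X Y Z x - Ω.toFun x (D Y x (X x)) (Z x) - Ω.toFun x (Y x) (D Z x (X x))

/-- `D` is an almost symplectic connection for `Ω`: it is a smooth connection with `∇Ω = 0`. -/
structure IsAlmostSymplecticConnection (D : LinearConnection n M)
    (Ω : AlmostSymplecticForm n M) : Prop where
  smooth : CovariantDerivative.ContMDiffCovariantDerivative D ∞
  parallel : ∀ (x : M) (X Y Z : ∀ x : M, TangentSpace (𝓡 (2 * n)) x),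
    SmoothAt X x → SmoothAt Y x → SmoothAt Z x → covDeriv D Ω X Y Z x = 0

/-- The matrix `Ω_{ij} = Ω(e_i, e_j)` of `Ω` in a frame `e` of `T_x M`. -/
noncomputable def gramMatrix (Ω : AlmostSymplecticForm n M) (x : M)
    (e : Module.Basis (Fin (2 * n)) ℝ (TangentSpace (𝓡 (2 * n)) x)) :
    Matrix (Fin (2 * n)) (Fin (2 * n)) ℝ :=
  Matrix.of fun i j ↦ Ω.toFun x (e i) (e j)

/-- The components `T_{ijk} = Ω(T^∇(e_i, e_j), e_k)` of the torsion
`T^∇(X,Y) = ∇_X Y - ∇_Y X - [X,Y]` in a frame `e` of `T_x M`. -/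
noncomputable def torsionComponent (D : LinearConnection n M) (Ω : AlmostSymplecticForm n M)
    (x : M) (e : Module.Basis (Fin (2 * n)) ℝ (TangentSpace (𝓡 (2 * n)) x))
    (i j k : Fin (2 * n)) : ℝ :=
  haveI : IsManifold (𝓡 (2 * n)) 2 M := .of_le (n := ∞) (by norm_cast)
  Ω.toFun x (D.torsion x (e i) (e j)) (e k)

/-- The quadratic torsion invariant
`t^∇ = ∑ T_{ijk} T_{pql} Ω^{ij} Ω^{kp} Ω^{ql}` at `x`, computed in the frame `e` of `T_x M`,
where `(Ω^{ij})` is the inverse of the matrix `(Ω_{ij})`. -/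
noncomputable def quadraticTorsionInvariant (D : LinearConnection n M)
    (Ω : AlmostSymplecticForm n M) (x : M)
    (e : Module.Basis (Fin (2 * n)) ℝ (TangentSpace (𝓡 (2 * n)) x)) : ℝ :=
  ∑ i, ∑ j, ∑ k, ∑ p, ∑ q, ∑ l,
    torsionComponent D Ω x e i j k * torsionComponent D Ω x e p q l *
      (gramMatrix Ω x e)⁻¹ i j * (gramMatrix Ω x e)⁻¹ k p * (gramMatrix Ω x e)⁻¹ q l

end

end AlmostSymplectic

namespace AlmostSymplectic

/-! Since `∇Ω = 0`, the exterior derivative `dΩ` is the cyclic sum of the lowered torsion, so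
closedness of `Ω` is a Bianchi-type identity `T_{ijk} + T_{jki} + T_{kij} = 0`. The invariant pairs,
through the inverse form, the two traces `a_k = T_{ijk} Ω^{ij}` and `b_p = T_{pql} Ω^{ql}`.
Contracting the identity with `Ω^{ij}` gives `a = -2b`, so the invariant is `-2 b_k b_p Ω^{kp}`, a
skew form evaluated on `(b, b)`. -/

/-- A quadratic contraction of a tensor `T` which is skew in its first two indices and satisfies
the cyclic identity vanishes, when indices are raised with a skew matrix `W`. -/
theorem sum_contraction_eq_zero_of_cyclic {ι : Type*} [Fintype ι] (T : ι → ι → ι → ℝ)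
    (W : Matrix ι ι ℝ) (hT : ∀ i j k, T i j k = -T j i k)
    (hcyc : ∀ i j k, T i j k + T j k i + T k i j = 0) (hW : ∀ i j, W i j = -W j i) :
    ∑ i, ∑ j, ∑ k, ∑ p, ∑ q, ∑ l, T i j k * T p q l * W i j * W k p * W q l = 0 := by
  let a : ι → ℝ := fun k ↦ ∑ i, ∑ j, T i j k * W i j
  let b : ι → ℝ := fun p ↦ ∑ q, ∑ l, T p q l * W q l
  have hab (k : ι) : a k = -2 * b k := by
    have h : ∑ i, ∑ j, (T i j k + T j k i + T k i j) * W i j = 0 := by simp [hcyc]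
    -- The signs from the skewness of `T` and of `W` cancel, so both remaining cyclic terms contract
    -- to `b k`.
    have h2 : ∑ i, ∑ j, T j k i * W i j = b k := by
      rw [Finset.sum_comm]
      refine Finset.sum_congr rfl fun j _ ↦ Finset.sum_congr rfl fun i _ ↦ ?_
      rw [hT, hW]
      ring
    simp only [add_mul, Finset.sum_add_distrib, h2] at h
    change a k + b k + b k = 0 at h
    linarith
  have hskew : ∑ k, ∑ p, b k * b p * W k p = 0 := by
    have h : ∑ k, ∑ p, b k * b p * W k p = -∑ k, ∑ p, b k * b p * W k p := by
      conv_lhs => rw [Finset.sum_comm]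
      simp only [← Finset.sum_neg_distrib]
      refine Finset.sum_congr rfl fun p _ ↦ Finset.sum_congr rfl fun k _ ↦ ?_
      rw [hW]
      ring
    linarith
  calc
    _ = ∑ i, ∑ j, ∑ k, ∑ p, T i j k * W i j * b p * W k p := by
      simp only [b, Finset.mul_sum, Finset.sum_mul]
      refine Finset.sum_congr rfl fun i _ ↦ Finset.sum_congr rfl fun j _ ↦
        Finset.sum_congr rfl fun k _ ↦ Finset.sum_congr rfl fun p _ ↦
        Finset.sum_congr rfl fun q _ ↦ Finset.sum_congr rfl fun l _ ↦ ?_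
      ring
    _ = ∑ k, ∑ i, ∑ j, ∑ p, T i j k * W i j * b p * W k p := by
      exact (Finset.sum_congr rfl fun i _ ↦ Finset.sum_comm).trans Finset.sum_comm
    _ = ∑ k, ∑ p, a k * b p * W k p := by
      refine Finset.sum_congr rfl fun k _ ↦ ?_
      simp only [a, Finset.sum_mul]
      exact (Finset.sum_congr rfl fun i _ ↦ Finset.sum_comm).trans Finset.sum_comm
    _ = -2 * ∑ k, ∑ p, b k * b p * W k p := by
      simp only [hab, Finset.mul_sum]
      refine Finset.sum_congr rfl fun k _ ↦ Finset.sum_congr rfl fun p _ ↦ ?_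
      ring
    _ = 0 := by rw [hskew, mul_zero]

theorem inv_apply_skew {ι : Type*} [Fintype ι] [DecidableEq ι] (A : Matrix ι ι ℝ)
    (hA : ∀ i j, A i j = -A j i) (i j : ι) : A⁻¹ i j = -A⁻¹ j i := by
  have hAt : A.transpose = -A := by
    ext i j
    simpa using hA j i
  have h : (A⁻¹).transpose = -A⁻¹ := by
    rw [Matrix.transpose_nonsing_inv, hAt]
    by_cases hdet : IsUnit A.det
    · refine Matrix.inv_eq_right_inv ?_
      rw [neg_mul_neg, Matrix.mul_nonsing_inv _ hdet]
    -- For singular `A`, both inverses take the default value `0`.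
    · have hdet' : ¬IsUnit (-A).det := by rwa [← hAt, Matrix.det_transpose]
      rw [Matrix.nonsing_inv_apply_not_isUnit _ hdet, Matrix.nonsing_inv_apply_not_isUnit _ hdet',
        neg_zero]
  simpa using congrFun (congrFun h j) i

variable {n : ℕ} {M : Type*} [TopologicalSpace M]
  [ChartedSpace (EuclideanSpace ℝ (Fin (2 * n))) M] [IsManifold (𝓡 (2 * n)) ∞ M]

theorem AlmostSymplecticForm.apply_swap (Ω : AlmostSymplecticForm n M) (x : M)
    (v w : TangentSpace (𝓡 (2 * n)) x) : Ω.toFun x v w = -Ω.toFun x w v := by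
  have h := Ω.alternating x (v + w)
  simp only [map_add, add_apply, Ω.alternating, zero_add, add_zero] at h
  linarith

theorem torsionComponent_swap (D : LinearConnection n M) (Ω : AlmostSymplecticForm n M)
    (x : M) (e : Module.Basis (Fin (2 * n)) ℝ (TangentSpace (𝓡 (2 * n)) x))
    (i j k : Fin (2 * n)) :
    torsionComponent D Ω x e i j k = -torsionComponent D Ω x e j i k := by
  have : IsManifold (𝓡 (2 * n)) 2 M := .of_le (n := ∞) (by norm_cast)
  simp only [torsionComponent]
  rw [D.torsion_antisymm, map_neg, neg_apply]

open VectorField in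
/-- If `∇Ω = 0`, then `dΩ(X,Y,Z)` is the cyclic sum of `Ω(T^∇(X,Y),Z)`. -/
theorem IsAlmostSymplecticConnection.extDeriv_eq {D : LinearConnection n M}
    {Ω : AlmostSymplecticForm n M} (hD : IsAlmostSymplecticConnection D Ω)
    [IsManifold (𝓡 (2 * n)) 2 M] {x : M}
    {X Y Z : ∀ x : M, TangentSpace (𝓡 (2 * n)) x}
    (hX : SmoothAt X x) (hY : SmoothAt Y x) (hZ : SmoothAt Z x) :
    Ω.extDeriv X Y Z x = Ω.toFun x (D.torsion x (X x) (Y x)) (Z x)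
      + Ω.toFun x (D.torsion x (Y x) (Z x)) (X x)
      + Ω.toFun x (D.torsion x (Z x) (X x)) (Y x) := by
  have hX' := ContMDiffAt.mdifferentiableAt hX (by simp)
  have hY' := ContMDiffAt.mdifferentiableAt hY (by simp)
  have hZ' := ContMDiffAt.mdifferentiableAt hZ (by simp)
  rw [D.torsion_apply hX' hY', D.torsion_apply hY' hZ', D.torsion_apply hZ' hX']
  have h1 := hD.parallel x X Y Z hX hY hZ
  have h2 := hD.parallel x Y Z X hY hZ hX
  have h3 := hD.parallel x Z X Y hZ hX hY
  -- Moving each covariant derivative into the first slot makes the three parallelism equations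
  -- linear in the terms of the goal.
  rw [covDeriv, Ω.apply_swap x (Y x)] at h1
  rw [covDeriv, Ω.apply_swap x (Z x)] at h2
  rw [covDeriv, Ω.apply_swap x (X x)] at h3
  simp only [AlmostSymplecticForm.extDeriv, map_sub, sub_apply]
  linarith

/-- Closedness is tested on vector fields, so the frame vectors at `x` are extended to fields smooth
at `x`; the torsion terms only see their values there. -/
theorem IsAlmostSymplecticConnection.torsionComponent_cyclic {D : LinearConnection n M}
    {Ω : AlmostSymplecticForm n M} (hD : IsAlmostSymplecticConnection D Ω)
    (hΩ : Ω.IsSymplectic)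
    (x : M) (e : Module.Basis (Fin (2 * n)) ℝ (TangentSpace (𝓡 (2 * n)) x))
    (i j k : Fin (2 * n)) :
    torsionComponent D Ω x e i j k + torsionComponent D Ω x e j k i
      + torsionComponent D Ω x e k i j = 0 := by
  have : IsManifold (𝓡 (2 * n)) 2 M := .of_le (n := ∞) (by norm_cast)
  have hs (v : TangentSpace (𝓡 (2 * n)) x) :
      SmoothAt (FiberBundle.extend (EuclideanSpace ℝ (Fin (2 * n))) v) x :=
    FiberBundle.contMDiffAt_extend (𝓡 (2 * n)) (EuclideanSpace ℝ (Fin (2 * n))) v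
  have h := hD.extDeriv_eq (hs (e i)) (hs (e j)) (hs (e k))
  rw [hΩ x _ _ _ (hs (e i)) (hs (e j)) (hs (e k))] at h
  simpa only [FiberBundle.extend_apply_self, torsionComponent] using h.symm

end AlmostSymplectic

theorem mainTheorem7 {n : ℕ} {M : Type*} [TopologicalSpace M] [T2Space M] [SigmaCompactSpace M]
    [ChartedSpace (EuclideanSpace ℝ (Fin (2 * n))) M] [IsManifold (𝓡 (2 * n)) ∞ M]
    (Ω : AlmostSymplectic.AlmostSymplecticForm n M) (hΩ : Ω.IsSymplectic)
    (D : AlmostSymplectic.LinearConnection n M)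
    (hD : AlmostSymplectic.IsAlmostSymplecticConnection D Ω)
    (x : M) (e : Module.Basis (Fin (2 * n)) ℝ (TangentSpace (𝓡 (2 * n)) x)) :
    AlmostSymplectic.quadraticTorsionInvariant D Ω x e = 0 :=
  AlmostSymplectic.sum_contraction_eq_zero_of_cyclic _ _
    (AlmostSymplectic.torsionComponent_swap D Ω x e) (hD.torsionComponent_cyclic hΩ x e)
    (AlmostSymplectic.inv_apply_skew _ fun _ _ ↦ Ω.apply_swap x _ _)
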